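/- **Theorem 5.2 (model existence).** *Language.* Let $\mathsf V$ be a countably infinite set of variables and, for each $n\in\omega$, let $\mathsf{Pred}(n)$ be a countable set of $n$-ary predicate symbols (propositional variables if $n=0$). Let $\Phi$ be the set of formulas built from $\top,\bot$ and atoms $P(x_1,\dots,x_n)$ with $\land,\neg,\forall x,\Box$; $\supset$ and $\equiv$ are defined as usual. A uniform substitution is a function $s\colon\Phi\to\Phi$ given by assigning to every predicate symbol $P$ of every arity $n$ a formula $C_P$ and distinct variables $x_1,\dots,x_n$ (further free variables in $C_P$ are allowed): $s(\phi)$ results from $\phi$ by simultaneously replacing all atoms $P(y_1,\dots,y_n)$ by $C_P[y_1/x_1,\dots,y_n/x_n]$, where bound variables are renamed, in a fixed way, only where this is needed to avoid capture. Let $\mathsf{Sub}$ be the set of all uniform substitutions. *Logics.* A predicate modal logic is a set $L\subseteq\Phi$ that contains all classical predicate tautologies (that is, all substitution instances in $\Phi$ of classically valid first-order formulas) and is closed under modus ponens, uniform substitution, generalization (from $\phi$ to $\forall x\phi$) and the rule from $\phi\equiv\psi$ to $\Box\phi\equiv\Box\psi$. It is consistent if $\bot\notin L$. For distinct propositional variables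 $p,q$, $L$ satisfies MT if $\Box(p\land q)\supset\Box p\land\Box q\in L$, TP if $\Box\top\in L$, and CF if $\Box p\land\Box q\supset\Box(p\land q)\in L$. Given closed formulas $\alpha$ and $\beta_i$ ($i\in\omega$), $L$ admits the pair $$\alpha\supset\beta_i\ (i\in\omega),\qquad \frac{p\supset\beta_i\ (i\in\omega)}{p\supset\alpha}$$ if for every $s\in\mathsf{Sub}$: $s(\alpha\supset\beta_i)\in L$ for all $i$; and, for every $\phi\in\Phi$, $\phi\supset s(\alpha)\in L$ whenever $\phi\supset s(\beta_i)\in L$ for all $i$. The pair satisfies the countability condition if the set $\{\{s(\beta_i)\mid i\in\omega\}\mid s\in\mathsf{Sub}\}$ is countable. *Models.* A neighborhood model (with constant domain) is $M=\langle C,\mathcal N,\mathcal D,\mathcal I\rangle$ with non-empty sets $C,\mathcal D$, a map $\mathcal N\colon C\to\mathcal P(\mathcal P(C))$ and relations $P^{\mathcal I}(c)\subseteq\mathcal D^n$ for $c\in C$, $P\in\mathsf{Pred}(n)$. For an assignment $\mathcal A\colon\mathsf V\to\mathcal D$, the value $v_{\mathcal A}(\phi)\subseteq C$ is defined by $v_{\mathcal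 A}(\top)=C$, $v_{\mathcal A}(\bot)=\emptyset$, $v_{\mathcal A}(P(x_1,\dots,x_n))=\{c\mid(\mathcal A(x_1),\dots,\mathcal A(x_n))\in P^{\mathcal I}(c)\}$, $v_{\mathcal A}(\phi\land\psi)=v_{\mathcal A}(\phi)\cap v_{\mathcal A}(\psi)$, $v_{\mathcal A}(\neg\phi)=C\setminus v_{\mathcal A}(\phi)$, $v_{\mathcal A}(\forall x\phi)=\bigcap_{d\in\mathcal D}v_{[d/x]\mathcal A}(\phi)$ and $v_{\mathcal A}(\Box\phi)=\{c\mid v_{\mathcal A}(\phi)\in\mathcal N(c)\}$. Write $M\models\phi$ if $v_{\mathcal A}(\phi)=C$ for every $\mathcal A$. $M$ satisfies MT, TP or CF if, for every $c\in C$, $\mathcal N(c)$ is upward closed under inclusion, contains $C$, or is closed under binary intersections, respectively. *Statement.* Let $L$ be a consistent predicate modal logic, and let $(\alpha_k,(\beta_{k,i})_{i\in\omega})_{k\in K}$, with $K$ countable, be families of closed formulas such that, for each $k\in K$, $L$ admits the pair given by $\alpha_k$ and $(\beta_{k,i})_{i\in\omega}$, and this pair satisfies the countability condition. Then there are a neighborhood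 model $M$ and an assignment $\mathcal A$ such that $$v_{\mathcal A}(s(\alpha_k))=\bigcap_{i\in\omega}v_{\mathcal A}(s(\beta_{k,i}))\qquad\text{for all } k\in K \text{ and } s\in\mathsf{Sub},$$ and, for every closed formula $\phi$, $$\phi\in L\iff M\models\phi .$$ Moreover, $M$ satisfies each of MT, TP and CF that $L$ satisfies. -/

import Mathlib

universe u v v' w

namespace PML

/-- Formulas of predicate modal logic over a set `V` of individual variables and sets `Pred n` of
`n`-ary predicate symbols (those of arity `0` are the propositional variables). -/
inductive Formula (V : Type u) (Pred : ℕ → Type v) : Type (max u v) where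
  | top : Formula V Pred
  | bot : Formula V Pred
  | atom {n : ℕ} (P : Pred n) (xs : Fin n → V) : Formula V Pred
  | and (φ ψ : Formula V Pred) : Formula V Pred
  | not (φ : Formula V Pred) : Formula V Pred
  | box (φ : Formula V Pred) : Formula V Pred
  | all (x : V) (φ : Formula V Pred) : Formula V Pred

namespace Formula

variable {V : Type u} {Pred : ℕ → Type v}

/-- `φ ⊃ ψ`. -/
def imp (φ ψ : Formula V Pred) : Formula V Pred := not (and φ (not ψ))

/-- `φ ≡ ψ`, that is, `(φ ⊃ ψ) ∧ (ψ ⊃ φ)`. -/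
def iff (φ ψ : Formula V Pred) : Formula V Pred := and (imp φ ψ) (imp ψ φ)

/-- A propositional variable as a formula. -/
def prop (p : Pred 0) : Formula V Pred := atom p Fin.elim0

open scoped Classical in
/-- The free variables of a formula. -/
noncomputable def freeVars : Formula V Pred → Finset V
  | .top => ∅
  | .bot => ∅
  | .atom _ xs => Finset.univ.image xs
  | .and φ ψ => freeVars φ ∪ freeVars ψ
  | .not φ => freeVars φ
  | .box φ => freeVars φ
  | .all x φ => (freeVars φ).erase x

/-- A formula is closed if it has no free variables. -/
def Closed (φ : Formula V Pred) : Prop := freeVars φ = ∅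

/-- No modal operator occurs in the formula: it is a formula of classical predicate logic. -/
def BoxFree : Formula V Pred → Prop
  | .top => True
  | .bot => True
  | .atom _ _ => True
  | .and φ ψ => BoxFree φ ∧ BoxFree ψ
  | .not φ => BoxFree φ
  | .box _ => False
  | .all _ φ => BoxFree φ

open scoped Classical in
/-- Satisfaction in a classical first-order structure with domain `D` and relations `R`.
It is used for formulas without modal operator only, so the clause for `box` is irrelevant. -/
def Satisfies {D : Type w} (R : ∀ n, Pred n → Set (Fin n → D)) :
    (V → D) → Formula V Pred → Prop
  | _, .top => True
  | _, .bot => False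
  | A, @Formula.atom _ _ n P xs => (fun i => A (xs i)) ∈ R n P
  | A, .and φ ψ => Satisfies R A φ ∧ Satisfies R A ψ
  | A, .not φ => ¬ Satisfies R A φ
  | _, .box _ => False
  | A, .all x φ => ∀ d : D, Satisfies R (Function.update A x d) φ

/-- A formula without modal operator that is true in every classical first-order structure (with
non-empty domain) under every assignment. -/
def ClassicallyValid (φ : Formula V Pred) : Prop :=
  BoxFree φ ∧ ∀ (D : Type u) [Nonempty D] (R : ∀ n, Pred n → Set (Fin n → D)) (A : V → D),
    Satisfies R A φ

open scoped Classical in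
/-- The variable `x` itself if it is not in the finite set `S`, and otherwise a chosen variable
outside `S`; this is the name given to a bound variable `x` that must avoid `S`. -/
noncomputable def pick [Infinite V] (S : Finset V) (x : V) : V :=
  if x ∈ S then (Infinite.exists_notMem_finset S).choose else x

open scoped Classical in
/-- Simultaneous capture-avoiding substitution of the variable `ρ x` for all free occurrences of
`x`, for all `x`. A bound variable is renamed only if it would capture a substituted one. -/
noncomputable def rename [Infinite V] : (V → V) → Formula V Pred → Formula V Pred
  | _, .top => .top
  | _, .bot => .bot
  | ρ, .atom P xs => .atom P (fun i => ρ (xs i))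
  | ρ, .and φ ψ => .and (rename ρ φ) (rename ρ ψ)
  | ρ, .not φ => .not (rename ρ φ)
  | ρ, .box φ => .box (rename ρ φ)
  | ρ, .all x φ =>
      let z := pick (((freeVars φ).erase x).image ρ) x
      .all z (rename (Function.update ρ x z) φ)

end Formula

open Formula (imp iff prop freeVars pick rename ClassicallyValid)

/-- The data of a uniform substitution of formulas (over the predicate symbols `Pred'`) for the
predicate symbols in `Pred`: every `n`-ary `P` is assigned a formula `body n P` together with a list
`args n P` of `n` distinct variables standing for the arguments of `P`. The formula `body n P` may
have further free variables, the parameters. -/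
structure Substitution (V : Type u) (Pred : ℕ → Type v) (Pred' : ℕ → Type v') where
  args : ∀ n, Pred n → (Fin n ↪ V)
  body : ∀ n, Pred n → Formula V Pred'

namespace Substitution

variable {V : Type u} {Pred : ℕ → Type v} {Pred' : ℕ → Type v'}

open scoped Classical in
/-- The parameters of the formulas that are substituted for the predicate symbols in a formula. -/
noncomputable def params (s : Substitution V Pred Pred') : Formula V Pred → Finset V
  | .top => ∅
  | .bot => ∅
  | @Formula.atom _ _ n P _ => freeVars (s.body n P) \ Finset.univ.image (s.args n P)
  | .and φ ψ => params s φ ∪ params s ψ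
  | .not φ => params s φ
  | .box φ => params s φ
  | .all _ φ => params s φ

open scoped Classical in
/-- Auxiliary function for `apply`: it carries the renaming `ρ` of variables caused by the renaming
of bound variables further outside. An atomic formula `P(y₁,…,yₙ)` becomes the body of `P` with
`ρ yᵢ` in place of its `i`-th argument variable; a bound variable is renamed only if it would capture
a parameter or a renamed variable. -/
noncomputable def applyAux [Infinite V] (s : Substitution V Pred Pred') :
    (V → V) → Formula V Pred → Formula V Pred'
  | _, .top => .top
  | _, .bot => .bot
  | ρ, @Formula.atom _ _ n P ys =>
      rename (Function.extend (s.args n P) (fun i => ρ (ys i)) id) (s.body n P)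
  | ρ, .and φ ψ => .and (applyAux s ρ φ) (applyAux s ρ ψ)
  | ρ, .not φ => .not (applyAux s ρ φ)
  | ρ, .box φ => .box (applyAux s ρ φ)
  | ρ, .all x φ =>
      let z := pick (((freeVars φ).erase x).image ρ ∪ s.params φ) x
      .all z (applyAux s (Function.update ρ x z) φ)

/-- The function on formulas given by a uniform substitution: every atomic subformula
`P(y₁,…,yₙ)` is replaced by the corresponding instance of the formula assigned to `P`. -/
noncomputable def apply [Infinite V] (s : Substitution V Pred Pred') (φ : Formula V Pred) :
    Formula V Pred' :=
  applyAux s id φ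

end Substitution

section Logic

variable {V : Type u} {Pred : ℕ → Type v}

/-- Classical predicate tautologies among the formulas of predicate modal logic: the substitution
instances of classically valid formulas of first-order logic, written with countably many schematic
predicate letters of each arity. (Schematic letters are used so that a language with few predicate
symbols also has all instances such as `φ ⊃ φ`.) -/
def IsTautology [Infinite V] (φ : Formula V Pred) : Prop :=
  ∃ (χ : Formula V (fun _ => ℕ)) (s : Substitution V (fun _ => ℕ) Pred),
    ClassicallyValid χ ∧ φ = s.apply χ

/-- Predicate modal logics. -/
structure IsPredicateModalLogic [Infinite V] (L : Set (Formula V Pred)) : Prop where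
  tautology : ∀ φ, IsTautology φ → φ ∈ L
  modusPonens : ∀ φ ψ, imp φ ψ ∈ L → φ ∈ L → ψ ∈ L
  uniformSubst : ∀ (s : Substitution V Pred Pred) (φ), φ ∈ L → s.apply φ ∈ L
  generalization : ∀ (φ) (x : V), φ ∈ L → Formula.all x φ ∈ L
  congruence : ∀ φ ψ, iff φ ψ ∈ L → iff (Formula.box φ) (Formula.box ψ) ∈ L

/-- `L` is consistent. -/
def Consistent (L : Set (Formula V Pred)) : Prop := Formula.bot ∉ L

/-- `L` is monotonic: `□(p ∧ q) ⊃ □p ∧ □q ∈ L` for propositional variables `p`, `q`. -/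
def LogicMT (L : Set (Formula V Pred)) : Prop :=
  ∃ p q : Pred 0, p ≠ q ∧
    imp (.box (.and (prop p) (prop q))) (.and (.box (prop p)) (.box (prop q))) ∈ L

/-- `L` is topped: `□⊤ ∈ L`. -/
def LogicTP (L : Set (Formula V Pred)) : Prop := Formula.box Formula.top ∈ L

/-- `L` is closed under finite intersections: `□p ∧ □q ⊃ □(p ∧ q) ∈ L` for propositional variables
`p`, `q`. -/
def LogicCF (L : Set (Formula V Pred)) : Prop :=
  ∃ p q : Pred 0, p ≠ q ∧
    imp (.and (.box (prop p)) (.box (prop q))) (.box (.and (prop p) (prop q))) ∈ L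

/-- `L` admits the pair of the axiom schemata `α ⊃ βᵢ` (`i ∈ ω`) and the `ω`-rule that infers
`p ⊃ α` from the premises `p ⊃ βᵢ` (`i ∈ ω`). -/
def Admits [Infinite V] (L : Set (Formula V Pred)) (α : Formula V Pred)
    (β : ℕ → Formula V Pred) : Prop :=
  (∀ (s : Substitution V Pred Pred) (i : ℕ), s.apply (imp α (β i)) ∈ L) ∧
  (∀ (s : Substitution V Pred Pred) (φ : Formula V Pred),
    (∀ i, imp φ (s.apply (β i)) ∈ L) → imp φ (s.apply α) ∈ L)

/-- The countability condition: there are only countably many sets `{s(βᵢ) | i ∈ ω}`, where `s`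
ranges over all uniform substitutions. -/
def CountableInstances [Infinite V] (β : ℕ → Formula V Pred) : Prop :=
  {X : Set (Formula V Pred) | ∃ s : Substitution V Pred Pred,
    X = {φ | ∃ i : ℕ, φ = s.apply (β i)}}.Countable

end Logic

/-- Neighborhood models with constant domain: `C` is the set of worlds, `N` the neighborhood system,
`D` the domain, and `I c n P` the `n`-ary relation on `D` that interprets `P` at the world `c`. -/
structure NeighborhoodModel (Pred : ℕ → Type v) where
  C : Type w
  nonempty_C : Nonempty C
  N : C → Set (Set C)
  D : Type w
  nonempty_D : Nonempty D
  I : C → ∀ n, Pred n → Set (Fin n → D)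

namespace NeighborhoodModel

variable {V : Type u} {Pred : ℕ → Type v}

open scoped Classical in
/-- The valuation of formulas in a model under an assignment: a set of worlds. -/
def val (M : NeighborhoodModel.{v, w} Pred) : (V → M.D) → Formula V Pred → Set M.C
  | _, .top => Set.univ
  | _, .bot => ∅
  | A, @Formula.atom _ _ n P xs => {c | (fun i => A (xs i)) ∈ M.I c n P}
  | A, .and φ ψ => val M A φ ∩ val M A ψ
  | A, .not φ => (val M A φ)ᶜ
  | A, .box φ => {c | val M A φ ∈ M.N c}
  | A, .all x φ => ⋂ d : M.D, val M (Function.update A x d) φ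

/-- `M ⊨ φ`: the formula is true at every world under every assignment. -/
def Models (M : NeighborhoodModel.{v, w} Pred) (φ : Formula V Pred) : Prop :=
  ∀ (c : M.C) (A : V → M.D), c ∈ M.val A φ

/-- Every `N c` is upward closed. -/
def MT (M : NeighborhoodModel.{v, w} Pred) : Prop :=
  ∀ c, ∀ X Y : Set M.C, X ∈ M.N c → X ⊆ Y → Y ∈ M.N c

/-- Every `N c` contains the set of all worlds. -/
def TP (M : NeighborhoodModel.{v, w} Pred) : Prop :=
  ∀ c, Set.univ ∈ M.N c

/-- Every `N c` is closed under binary intersections. -/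
def CF (M : NeighborhoodModel.{v, w} Pred) : Prop :=
  ∀ c, ∀ X Y : Set M.C, X ∈ M.N c → Y ∈ M.N c → X ∩ Y ∈ M.N c

end NeighborhoodModel

end PML

/-! The proof is a canonical model construction. Modulo provable equivalence, the formulas form a
Boolean algebra with an operation `□`. In it `∀x φ` is the infimum of its instances `φ[y/x]`,
because some `y` is fresh (`imp_all_of_forall_instances`), and admission of a pair makes `s(α)` the
infimum of the `s(βᵢ)`. The language is countable, so the countability condition leaves only
countably many such infima. By the Rasiowa–Sikorski argument (`exists_isWorld_notMem`), every
non-theorem is then avoided by some ultrafilter that contains `L` and respects all these infima.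

These ultrafilters are the worlds and the variables are the domain. The neighborhoods of `Γ` are the
truth sets of those `φ` with `□φ ∈ Γ`. This is well defined because inclusion of truth sets is
provable implication (`truthSet_subset_iff`), and no compatibility between `□` and the infima is
needed. Assignments are renamings of variables, so the truth lemma (`val_canonicalModel`) needs
renamings to compose. Because of bound variables they do so only up to provable equivalence
(`rename_rename`). -/

namespace PML

open scoped Classical

/-! ### Countability of the language, renaming of variables, propositional skeletons -/

namespace Formula

variable {V : Type u} {Pred : ℕ → Type v}

/-- A Gödel numbering of formulas. -/
noncomputable def code [Encodable V] [∀ n, Encodable (Pred n)] : Formula V Pred → ℕ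
  | .top => Nat.pair 0 0
  | .bot => Nat.pair 1 0
  | @Formula.atom _ _ n P xs =>
      Nat.pair 2 (Encodable.encode (⟨n, P, xs⟩ : Σ n, Pred n × (Fin n → V)))
  | .and φ ψ => Nat.pair 3 (Nat.pair (code φ) (code ψ))
  | .not φ => Nat.pair 4 (code φ)
  | .box φ => Nat.pair 5 (code φ)
  | .all x φ => Nat.pair 6 (Nat.pair (Encodable.encode x) (code φ))

theorem code_injective [Encodable V] [∀ n, Encodable (Pred n)] :
    Function.Injective (code : Formula V Pred → ℕ) := by
  intro φ
  induction φ with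
  | top => intro ψ; cases ψ <;> simp [code]
  | bot => intro ψ; cases ψ <;> simp [code]
  | @atom n P xs =>
    intro ψ
    cases ψ with
    | @atom m Q ys =>
      intro h
      simp only [code, Nat.pair_eq_pair, true_and, Encodable.encode_inj] at h
      cases h
      rfl
    | _ => simp [code]
  | and φ ψ ih₁ ih₂ =>
    intro χ
    cases χ with
    | and a b =>
      intro h
      simp only [code, Nat.pair_eq_pair, true_and] at h
      rw [ih₁ h.1, ih₂ h.2]
    | _ => simp [code]
  | not φ ih =>
    intro χ
    cases χ with
    | not a =>
      intro h
      simp only [code, Nat.pair_eq_pair, true_and] at h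
      rw [ih h]
    | _ => simp [code]
  | box φ ih =>
    intro χ
    cases χ with
    | box a =>
      intro h
      simp only [code, Nat.pair_eq_pair, true_and] at h
      rw [ih h]
    | _ => simp [code]
  | all x φ ih =>
    intro χ
    cases χ with
    | all y a =>
      intro h
      simp only [code, Nat.pair_eq_pair, true_and, Encodable.encode_inj] at h
      rw [h.1, ih h.2]
    | _ => simp [code]

theorem countable [Countable V] [∀ n, Countable (Pred n)] : Countable (Formula V Pred) := by
  have : Encodable V := Encodable.ofCountable V
  have : ∀ n, Encodable (Pred n) := fun n => Encodable.ofCountable (Pred n)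
  exact code_injective.countable

instance : Nonempty (Formula V Pred) := ⟨.top⟩

theorem pick_notMem [Infinite V] (S : Finset V) (x : V) : pick S x ∉ S := by
  unfold pick
  split_ifs with h
  · exact (Infinite.exists_notMem_finset S).choose_spec
  · exact h

theorem pick_of_notMem [Infinite V] {S : Finset V} {x : V} (h : x ∉ S) : pick S x = x :=
  if_neg h

theorem rename_congr [Infinite V] (φ : Formula V Pred) :
    ∀ {ρ σ : V → V}, (∀ y ∈ freeVars φ, ρ y = σ y) → rename ρ φ = rename σ φ := by
  induction φ with
  | top => intros; rfl
  | bot => intros; rfl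
  | atom P xs =>
    intro ρ σ h
    simp only [rename]
    congr 1
    funext i
    exact h _ (by simp [freeVars])
  | and φ ψ ih₁ ih₂ =>
    intro ρ σ h
    simp only [rename]
    rw [ih₁ fun y hy => h y (by simp [freeVars, hy]), ih₂ fun y hy => h y (by simp [freeVars, hy])]
  | not φ ih => intro ρ σ h; simp only [rename]; rw [ih h]
  | box φ ih => intro ρ σ h; simp only [rename]; rw [ih h]
  | all x φ ih =>
    intro ρ σ h
    simp only [rename]
    rw [Finset.image_congr (s := (freeVars φ).erase x) (f := ρ) (g := σ) fun y hy => h y hy]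
    congr 1
    apply ih
    intro y hy
    by_cases hyx : y = x
    · simp [hyx]
    · simp only [Function.update_of_ne hyx]
      exact h y (Finset.mem_erase.2 ⟨hyx, hy⟩)

theorem rename_id [Infinite V] (φ : Formula V Pred) : rename id φ = φ := by
  induction φ with
  | top => rfl
  | bot => rfl
  | atom P xs => rfl
  | and φ ψ ih₁ ih₂ => simp only [rename, ih₁, ih₂]
  | not φ ih => simp only [rename, ih]
  | box φ ih => simp only [rename, ih]
  | all x φ ih =>
    have hz : pick (((freeVars φ).erase x).image id) x = x := pick_of_notMem (by simp)
    have hu : Function.update (id : V → V) x x = id := Function.update_eq_self x id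
    simp only [rename, hz, hu, ih]

theorem rename_update_id_self [Infinite V] (x : V) (φ : Formula V Pred) :
    rename (Function.update id x x) φ = φ := by
  have hu : Function.update (id : V → V) x x = id := Function.update_eq_self x id
  rw [hu, rename_id]

/-- Freshness of `z` means that no free variable other than `x` is sent to `z`, so redirecting `z`
to `w` affects only `x`. -/
theorem rename_update_comp_update [Infinite V] {φ : Formula V Pred} {ρ : V → V} {x z : V}
    (hz : z ∉ ((freeVars φ).erase x).image ρ) (σ : V → V) (w : V) :
    rename (Function.update σ z w ∘ Function.update ρ x z) φ =
      rename (Function.update (σ ∘ ρ) x w) φ := by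
  refine rename_congr φ fun y hy => ?_
  by_cases hyx : y = x
  · simp [hyx]
  · have : ρ y ≠ z := fun h =>
      hz (h ▸ Finset.mem_image_of_mem _ (Finset.mem_erase.2 ⟨hyx, hy⟩))
    simp [hyx, this]

theorem rename_of_closed [Infinite V] {φ : Formula V Pred} (h : φ.Closed) (ρ : V → V) :
    rename ρ φ = φ := by
  rw [rename_congr φ (σ := id) fun y hy => by rw [show freeVars φ = ∅ from h] at hy; simp at hy,
    rename_id]

theorem image_update_erase (S : Finset V) (ρ : V → V) (x z : V)
    (hz : z ∉ (S.erase x).image ρ) :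
    (S.image (Function.update ρ x z)).erase z = (S.erase x).image ρ := by
  ext w
  simp only [Finset.mem_erase, Finset.mem_image]
  constructor
  · rintro ⟨hw, y, hy, rfl⟩
    have hyx : y ≠ x := by rintro rfl; simp at hw
    exact ⟨y, ⟨hyx, hy⟩, by simp [hyx]⟩
  · rintro ⟨y, ⟨hyx, hy⟩, rfl⟩
    refine ⟨?_, y, hy, by simp [hyx]⟩
    rintro rfl
    exact hz (Finset.mem_image.2 ⟨y, Finset.mem_erase.2 ⟨hyx, hy⟩, rfl⟩)

theorem freeVars_rename [Infinite V] (φ : Formula V Pred) :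
    ∀ ρ : V → V, freeVars (rename ρ φ) = (freeVars φ).image ρ := by
  induction φ with
  | top => intro ρ; simp [rename, freeVars]
  | bot => intro ρ; simp [rename, freeVars]
  | atom P xs => intro ρ; ext; simp [rename, freeVars]
  | and φ ψ ih₁ ih₂ => intro ρ; simp only [rename, freeVars, ih₁, ih₂, Finset.image_union]
  | not φ ih => intro ρ; simp only [rename, freeVars, ih]
  | box φ ih => intro ρ; simp only [rename, freeVars, ih]
  | all x φ ih =>
    intro ρ
    simp only [rename, freeVars, ih]
    exact image_update_erase _ _ _ _ (pick_notMem _ _)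

/-- `v` is a truth assignment that respects the propositional connectives. -/
structure IsValuation (v : Formula V Pred → Prop) : Prop where
  top : v .top
  bot : ¬ v .bot
  and : ∀ φ ψ, v (.and φ ψ) ↔ v φ ∧ v ψ
  not : ∀ φ, v (.not φ) ↔ ¬ v φ

namespace IsValuation

variable {v : Formula V Pred → Prop}

theorem imp (hv : IsValuation v) (φ ψ : Formula V Pred) :
    v (Formula.imp φ ψ) ↔ (v φ → v ψ) := by
  simp only [Formula.imp, hv.not, hv.and]
  tauto

theorem iff (hv : IsValuation v) (φ ψ : Formula V Pred) :
    v (Formula.iff φ ψ) ↔ (v φ ↔ v ψ) := by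
  simp only [Formula.iff, hv.and, hv.imp]
  tauto

end IsValuation

/-- The propositional skeleton of a formula: maximal subformulas that are not propositional
combinations become propositional letters, numbered by `e`. -/
def skeleton (e : Formula V Pred → ℕ) : Formula V Pred → Formula V (fun _ => ℕ)
  | .top => .top
  | .bot => .bot
  | .and φ ψ => .and (skeleton e φ) (skeleton e ψ)
  | .not φ => .not (skeleton e φ)
  | .atom P xs => prop (Pred := fun _ => ℕ) (e (.atom P xs))
  | .box φ => prop (Pred := fun _ => ℕ) (e (.box φ))
  | .all x φ => prop (Pred := fun _ => ℕ) (e (.all x φ))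

theorem boxFree_skeleton (e : Formula V Pred → ℕ) (φ : Formula V Pred) :
    BoxFree (skeleton e φ) := by
  induction φ <;> simp_all [skeleton, BoxFree, prop]

end Formula

open Formula (imp iff prop freeVars pick rename)

/-! ### Substitutions for schematic letters of arity 0 and 1 -/

namespace Substitution

variable {V : Type u} {Pred : ℕ → Type v} {Pred' : ℕ → Type v'} [Infinite V]

theorem apply_prop (s : Substitution V Pred Pred') (p : Pred 0) :
    s.apply (prop p) = s.body 0 p := by
  have : Function.extend (s.args 0 p) (fun i => id ((Fin.elim0 : Fin 0 → V) i)) id = id := by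
    funext y
    exact Function.extend_apply' _ _ _ (by rintro ⟨i, _⟩; exact i.elim0)
  unfold apply prop applyAux
  rw [this, Formula.rename_id]

/-- The substitution that replaces the propositional letters by the formulas `f` and the unary
letters by the formulas `g` with argument variable `x`. -/
noncomputable def unary (x : V) (f : Pred 0 → Formula V Pred') (g : Pred 1 → Formula V Pred') :
    Substitution V Pred Pred' where
  args := fun n _ => if h : n = 1 then ⟨fun _ => x, fun i j _ => by subst h; exact Subsingleton.elim i j⟩
    -- A filler: for arity 0 the list is empty, and for arity at least 2 the body is `⊤`.
    else Fin.valEmbedding.trans (Infinite.natEmbedding V)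
  body := fun n => match n with
    | 0 => f
    | 1 => g
    | _ => fun _ => .top

theorem unary_body_zero (x : V) (f : Pred 0 → Formula V Pred') (g : Pred 1 → Formula V Pred') :
    (unary x f g).body 0 = f := rfl

theorem unary_args_one (x : V) (f : Pred 0 → Formula V Pred') (g : Pred 1 → Formula V Pred')
    (P : Pred 1) (i : Fin 1) : (unary x f g).args 1 P i = x := rfl

theorem extend_unary_args (x : V) (f : Pred 0 → Formula V Pred') (g : Pred 1 → Formula V Pred')
    (P : Pred 1) (y : V) :
    Function.extend ((unary x f g).args 1 P) (fun _ => y) id = Function.update id x y := by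
  funext w
  by_cases hw : w = x
  · subst hw
    rw [Function.update_self]
    exact ((unary w f g).args 1 P).injective.extend_apply (fun _ => y) id 0
  · rw [Function.update_of_ne hw, Function.extend_apply']
    rintro ⟨i, hi⟩
    exact hw (hi.symm.trans (unary_args_one x f g P i))

theorem apply_unary_atom (x : V) (f : Pred 0 → Formula V Pred') (g : Pred 1 → Formula V Pred')
    (P : Pred 1) (y : V) :
    (unary x f g).apply (.atom P fun _ => y) = rename (Function.update id x y) (g P) := by
  unfold apply applyAux
  rw [← extend_unary_args x f g P y]
  rfl

theorem apply_unary_all (x : V) (f : Pred 0 → Formula V Pred') (g : Pred 1 → Formula V Pred')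
    (φ : Formula V Pred) (hx : x ∉ (unary x f g).params φ) :
    (unary x f g).apply (.all x φ) = .all x ((unary x f g).apply φ) := by
  have hz : pick (((freeVars φ).erase x).image id ∪ (unary x f g).params φ) x = x :=
    Formula.pick_of_notMem (by simp [hx])
  have hu : Function.update (id : V → V) x x = id := Function.update_eq_self x id
  simp only [apply, applyAux, hz, hu]

end Substitution

/-! ### Derivations in a predicate modal logic -/

section Derivations

variable {V : Type u} {Pred : ℕ → Type v} [Infinite V] {L : Set (Formula V Pred)}

namespace IsPredicateModalLogic

open Formula (IsValuation)

/-- Every classical structure induces, through skeletons, a truth assignment on formulas, so the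
skeleton of `φ` is classically valid. Replacing each letter by the formula that it numbers gives
back `φ`. -/
theorem mem_of_forall_valuation [Countable V] [∀ n, Countable (Pred n)]
    (hL : IsPredicateModalLogic L) {φ : Formula V Pred}
    (h : ∀ v : Formula V Pred → Prop, IsValuation v → v φ) : φ ∈ L := by
  have : Countable (Formula V Pred) := Formula.countable
  obtain ⟨e, he⟩ := exists_injective_nat (Formula V Pred)
  obtain ⟨x⟩ : Nonempty V := inferInstance
  let s : Substitution V (fun _ => ℕ) Pred :=
    .unary x (Function.invFun e) (fun _ => .top)
  have hs : ∀ ψ : Formula V Pred, s.apply (Formula.skeleton e ψ) = ψ := by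
    have hprop : ∀ ψ : Formula V Pred, s.apply (prop (Pred := fun _ => ℕ) (e ψ)) = ψ := fun ψ => by
      rw [Substitution.apply_prop]
      exact Function.leftInverse_invFun he ψ
    intro ψ
    induction ψ with
    | top => rfl
    | bot => rfl
    | atom P xs => exact hprop _
    | and φ ψ ih₁ ih₂ => exact congrArg₂ Formula.and ih₁ ih₂
    | not φ ih => exact congrArg Formula.not ih
    | box φ _ => exact hprop _
    | all x φ _ => exact hprop _
  refine hL.tautology _ ⟨Formula.skeleton e φ, s, ⟨Formula.boxFree_skeleton e φ, ?_⟩, (hs φ).symm⟩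
  intro D _ R A
  exact h (fun ψ => Formula.Satisfies R A (Formula.skeleton e ψ))
    ⟨trivial, id, fun _ _ => Iff.rfl, fun _ => Iff.rfl⟩

theorem mem_of_entails [Countable V] [∀ n, Countable (Pred n)]
    (hL : IsPredicateModalLogic L) {φ χ : Formula V Pred} (hφ : φ ∈ L)
    (h : ∀ v : Formula V Pred → Prop, IsValuation v → v φ → v χ) : χ ∈ L :=
  hL.modusPonens φ χ (hL.mem_of_forall_valuation fun v hv => (hv.imp _ _).2 (h v hv)) hφ

theorem mem_of_entails₂ [Countable V] [∀ n, Countable (Pred n)]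
    (hL : IsPredicateModalLogic L) {φ ψ χ : Formula V Pred} (hφ : φ ∈ L) (hψ : ψ ∈ L)
    (h : ∀ v : Formula V Pred → Prop, IsValuation v → v φ → v ψ → v χ) : χ ∈ L :=
  hL.modusPonens ψ χ (hL.mem_of_entails hφ fun v hv h' => (hv.imp _ _).2 (h v hv h')) hψ

theorem imp_trans [Countable V] [∀ n, Countable (Pred n)] (hL : IsPredicateModalLogic L)
    {φ ψ χ : Formula V Pred} (h₁ : imp φ ψ ∈ L) (h₂ : imp ψ χ ∈ L) : imp φ χ ∈ L :=
  hL.mem_of_entails₂ h₁ h₂ fun v hv h₁ h₂ => by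
    rw [hv.imp] at *
    exact h₂ ∘ h₁

theorem iff_left [Countable V] [∀ n, Countable (Pred n)] (hL : IsPredicateModalLogic L)
    {φ ψ : Formula V Pred} (h : iff φ ψ ∈ L) : imp φ ψ ∈ L :=
  hL.mem_of_entails h fun v hv h => by
    rw [hv.iff] at h
    exact (hv.imp _ _).2 h.1

theorem iff_right [Countable V] [∀ n, Countable (Pred n)] (hL : IsPredicateModalLogic L)
    {φ ψ : Formula V Pred} (h : iff φ ψ ∈ L) : imp ψ φ ∈ L :=
  hL.mem_of_entails h fun v hv h => by
    rw [hv.iff] at h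
    exact (hv.imp _ _).2 h.2

theorem iff_intro [Countable V] [∀ n, Countable (Pred n)] (hL : IsPredicateModalLogic L)
    {φ ψ : Formula V Pred} (h₁ : imp φ ψ ∈ L) (h₂ : imp ψ φ ∈ L) : iff φ ψ ∈ L :=
  hL.mem_of_entails₂ h₁ h₂ fun _ hv h₁ h₂ => (hv.and _ _).2 ⟨h₁, h₂⟩

theorem iff_refl [Countable V] [∀ n, Countable (Pred n)] (hL : IsPredicateModalLogic L)
    (φ : Formula V Pred) : iff φ φ ∈ L :=
  hL.mem_of_forall_valuation fun _ hv => (hv.iff _ _).2 Iff.rfl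

theorem instantiation (hL : IsPredicateModalLogic L) (x y : V) (φ : Formula V Pred) :
    imp (.all x φ) (rename (Function.update id x y) φ) ∈ L := by
  let χ : Formula V (fun _ => ℕ) :=
    imp (.all x (@Formula.atom _ (fun _ => ℕ) 1 (0 : ℕ) fun _ => x))
      (@Formula.atom _ (fun _ => ℕ) 1 (0 : ℕ) fun _ => y)
  let s : Substitution V (fun _ => ℕ) Pred := .unary x (fun _ => .top) (fun _ => φ)
  refine hL.tautology _ ⟨χ, s, ⟨⟨trivial, trivial⟩, ?_⟩, ?_⟩
  · intro D _ R A h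
    obtain ⟨h₁, h₂⟩ := h
    have := h₁ (A y)
    simp only [Formula.Satisfies, Function.update_self] at this h₂
    exact h₂ this
  · have h₁ : s.apply (.all x (@Formula.atom _ (fun _ => ℕ) 1 (0 : ℕ) fun _ => x)) = .all x φ := by
      rw [Substitution.apply_unary_all, Substitution.apply_unary_atom, Formula.rename_update_id_self]
      -- `x` is the argument variable, hence not a parameter, and the quantifier over `x` is not
      -- renamed.
      · simp [Substitution.params, Substitution.unary_args_one]
    have h₂ : s.apply (@Formula.atom _ (fun _ => ℕ) 1 (0 : ℕ) fun _ => y)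
        = rename (Function.update id x y) φ := Substitution.apply_unary_atom _ _ _ _ _
    rw [← h₁, ← h₂]
    rfl

/-- An instance of the classical law `∀x (Q ⊃ P x) ⊃ (Q ⊃ ∀x P x)`. As `x` is not free in `φ`, it is
not a parameter of the substitution, which therefore leaves the bound `x` alone. -/
theorem imp_all (hL : IsPredicateModalLogic L) {x : V} {φ ψ : Formula V Pred}
    (hx : x ∉ freeVars φ) (h : imp φ ψ ∈ L) : imp φ (.all x ψ) ∈ L := by
  let P : Formula V (fun _ => ℕ) := @Formula.atom _ (fun _ => ℕ) 1 (0 : ℕ) fun _ => x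
  let Q : Formula V (fun _ => ℕ) := prop (Pred := fun _ => ℕ) (0 : ℕ)
  let s : Substitution V (fun _ => ℕ) Pred := .unary x (fun _ => φ) (fun _ => ψ)
  have hP : s.apply P = ψ := by
    have := Substitution.apply_unary_atom (Pred := fun _ => ℕ) x (fun _ => φ) (fun _ => ψ) 0 x
    rwa [Formula.rename_update_id_self] at this
  have hQ : s.apply Q = φ := Substitution.apply_prop s _
  have hxP : x ∉ s.params P := by
    simp [P, s, Substitution.params, Substitution.unary_args_one]
  have hxQ : x ∉ s.params Q := by
    simp [Q, s, prop, Substitution.params, Substitution.unary_body_zero, hx]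
  have h₁ : s.apply (.all x P) = .all x ψ :=
    (Substitution.apply_unary_all _ _ _ _ hxP).trans (congrArg (Formula.all x) hP)
  have h₂ : s.apply (.all x (imp Q P)) = .all x (imp φ ψ) :=
    (Substitution.apply_unary_all _ _ _ _ (by
      simp only [imp, Substitution.params, Finset.mem_union, not_or]
      exact ⟨hxQ, hxP⟩)).trans (congrArg (Formula.all x) (congrArg₂ imp hQ hP))
  have key : imp (.all x (imp φ ψ)) (imp φ (.all x ψ)) ∈ L := by
    refine hL.tautology _ ⟨imp (.all x (imp Q P)) (imp Q (.all x P)), s, ⟨?_, ?_⟩, ?_⟩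
    · simp [imp, Formula.BoxFree, P, Q, prop]
    · intro D _ R A
      simp only [imp, Formula.Satisfies, P, Q, prop, Function.update_self]
      -- `Q` has no arguments, so its truth value does not depend on the value of `x`.
      have : ∀ d, (fun i : Fin 0 => Function.update A x d (i.elim0)) = fun i => A (i.elim0) :=
        fun d => funext fun i => i.elim0
      simp only [this]
      rintro ⟨h₁, h₂⟩
      exact h₂ fun ⟨hq, hn⟩ => hn fun d => by_contra fun hd => h₁ d ⟨hq, hd⟩
    · exact congrArg₂ imp h₂.symm (congrArg₂ imp hQ.symm h₁.symm)
  exact hL.modusPonens _ _ key (hL.generalization _ x h)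

theorem all_mono [Countable V] [∀ n, Countable (Pred n)] (hL : IsPredicateModalLogic L) {x : V}
    {φ ψ : Formula V Pred} (h : imp φ ψ ∈ L) : imp (.all x φ) (.all x ψ) ∈ L := by
  refine hL.imp_all (by simp [freeVars]) ?_
  have := hL.instantiation x x φ
  rw [Formula.rename_update_id_self] at this
  exact hL.imp_trans this h

/-- Change of bound variable: `w'` is not free in the left side, so it suffices to instantiate `w`
by `w'` and generalize. Composition of renamings is assumed for `φ` alone, so that the lemma can be
used in the induction that proves it. -/
theorem imp_rebind [Countable V] [∀ n, Countable (Pred n)] (hL : IsPredicateModalLogic L)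
    {τ : V → V} {x w w' : V} {φ : Formula V Pred}
    (hcomp : ∀ σ ρ : V → V, iff (rename σ (rename ρ φ)) (rename (σ ∘ ρ) φ) ∈ L)
    (hw : w ∉ ((freeVars φ).erase x).image τ) (hw' : w' ∉ ((freeVars φ).erase x).image τ) :
    imp (.all w (rename (Function.update τ x w) φ))
      (.all w' (rename (Function.update τ x w') φ)) ∈ L := by
  refine hL.imp_all ?_ ?_
  · rw [freeVars, Formula.freeVars_rename, Formula.image_update_erase _ _ _ _ hw]
    exact hw'
  · refine hL.imp_trans (hL.instantiation w w' _) ?_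
    refine hL.imp_trans (hL.iff_left (hcomp _ _)) (hL.iff_left ?_)
    rw [Formula.rename_update_comp_update hw, Function.id_comp]
    exact hL.iff_refl _

/-- Syntactic equality fails because the two sides may choose different bound variables. The
congruence rule carries the equivalence through `□`. -/
theorem rename_rename [Countable V] [∀ n, Countable (Pred n)] (hL : IsPredicateModalLogic L)
    (φ : Formula V Pred) :
    ∀ σ ρ : V → V, iff (rename σ (rename ρ φ)) (rename (σ ∘ ρ) φ) ∈ L := by
  induction φ with
  | top => intro σ ρ; exact hL.iff_refl _
  | bot => intro σ ρ; exact hL.iff_refl _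
  | atom P xs => intro σ ρ; exact hL.iff_refl _
  | and φ ψ ih₁ ih₂ =>
    intro σ ρ
    refine hL.mem_of_entails₂ (ih₁ σ ρ) (ih₂ σ ρ) fun v hv h₁ h₂ => ?_
    simp only [rename, hv.iff, hv.and] at *
    rw [h₁, h₂]
  | not φ ih =>
    intro σ ρ
    refine hL.mem_of_entails (ih σ ρ) fun v hv h => ?_
    simp only [rename, hv.iff, hv.not] at *
    rw [h]
  | box φ ih => intro σ ρ; exact hL.congruence _ _ (ih σ ρ)
  | all x φ ih =>
    intro σ ρ
    simp only [rename]
    set z := pick (((freeVars φ).erase x).image ρ) x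
    have hzρ : z ∉ ((freeVars φ).erase x).image ρ := Formula.pick_notMem _ _
    rw [Formula.freeVars_rename, Formula.image_update_erase _ _ _ _ hzρ, Finset.image_image]
    set S := ((freeVars φ).erase x).image (σ ∘ ρ)
    have hw := Formula.pick_notMem S z
    have hw' := Formula.pick_notMem S x
    set w := pick S z
    set w' := pick S x
    have hmid : iff (rename (Function.update σ z w) (rename (Function.update ρ x z) φ))
        (rename (Function.update (σ ∘ ρ) x w) φ) ∈ L := by
      have := ih (Function.update σ z w) (Function.update ρ x z)
      rwa [Formula.rename_update_comp_update hzρ] at this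
    -- The left side binds `w` and the right side `w'`, both outside `S`; `hmid` merges the
    -- renamings under the quantifier and `imp_rebind` exchanges the two variables.
    exact hL.iff_intro
      (hL.imp_trans (hL.all_mono (hL.iff_left hmid)) (hL.imp_rebind ih hw hw'))
      (hL.imp_trans (hL.imp_rebind ih hw' hw) (hL.all_mono (hL.iff_right hmid)))

/-- The universal quantification is the infimum of its instances. -/
theorem imp_all_of_forall_instances [Countable V] [∀ n, Countable (Pred n)]
    (hL : IsPredicateModalLogic L) {x : V} {θ φ : Formula V Pred}
    (h : ∀ y, imp θ (rename (Function.update id x y) φ) ∈ L) : imp θ (.all x φ) ∈ L := by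
  -- One fresh instance suffices: generalize over `y`, then rename the bound `y` back to `x`.
  obtain ⟨y, hy⟩ := Infinite.exists_notMem_finset (freeVars θ ∪ (freeVars φ).erase x)
  rw [Finset.mem_union, not_or] at hy
  have h₁ := hL.imp_all hy.1 (h y)
  have h₂ := hL.imp_rebind (τ := id) (x := x) (w := y) (w' := x) (hL.rename_rename φ)
    (by simpa using hy.2) (by simp)
  rw [Formula.rename_update_id_self] at h₂
  exact hL.imp_trans h₁ h₂

/-- The letters in the axiom are distinct, so one substitution sends them to arbitrary `φ` and `ψ`.
-/
theorem box_and_imp (hL : IsPredicateModalLogic L) (h : LogicMT L) (φ ψ : Formula V Pred) :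
    imp (.box (.and φ ψ)) (.and (.box φ) (.box ψ)) ∈ L := by
  obtain ⟨p, q, hpq, h⟩ := h
  obtain ⟨x⟩ : Nonempty V := inferInstance
  let s : Substitution V Pred Pred := .unary x (fun r => if r = p then φ else ψ) (fun _ => .top)
  have hp : s.apply (prop p) = φ := (Substitution.apply_prop s p).trans (if_pos rfl)
  have hq : s.apply (prop q) = ψ := (Substitution.apply_prop s q).trans (if_neg hpq.symm)
  rw [← hp, ← hq]
  exact hL.uniformSubst s _ h

theorem and_box_imp (hL : IsPredicateModalLogic L) (h : LogicCF L) (φ ψ : Formula V Pred) :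
    imp (.and (.box φ) (.box ψ)) (.box (.and φ ψ)) ∈ L := by
  obtain ⟨p, q, hpq, h⟩ := h
  obtain ⟨x⟩ : Nonempty V := inferInstance
  let s : Substitution V Pred Pred := .unary x (fun r => if r = p then φ else ψ) (fun _ => .top)
  have hp : s.apply (prop p) = φ := (Substitution.apply_prop s p).trans (if_pos rfl)
  have hq : s.apply (prop q) = ψ := (Substitution.apply_prop s q).trans (if_neg hpq.symm)
  rw [← hp, ← hq]
  exact hL.uniformSubst s _ h

/-- If `φ ⊃ ψ` is provable, then `φ` is equivalent to `φ ∧ ψ`, and the congruence rule applies. -/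
theorem box_mono [Countable V] [∀ n, Countable (Pred n)] (hL : IsPredicateModalLogic L)
    (hMT : LogicMT L) {φ ψ : Formula V Pred} (h : imp φ ψ ∈ L) : imp (.box φ) (.box ψ) ∈ L := by
  have h₁ : iff φ (.and φ ψ) ∈ L := hL.mem_of_entails h fun v hv h => by
    simp only [hv.iff, hv.and, hv.imp] at *
    tauto
  refine hL.mem_of_entails₂ (hL.congruence _ _ h₁) (hL.box_and_imp hMT φ ψ) fun v hv h₁ h₂ => ?_
  simp only [hv.iff, hv.and, hv.imp] at *
  tauto

end IsPredicateModalLogic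

/-! ### Worlds and the Rasiowa–Sikorski lemma -/

/-- `Γ` is a maximal consistent set of formulas that contains `L` and respects all the infinitary
meets in `T`, a set of pairs of a set of formulas and its infimum. -/
structure IsWorld (L : Set (Formula V Pred)) (T : Set (Set (Formula V Pred) × Formula V Pred))
    (Γ : Set (Formula V Pred)) : Prop where
  valuation : Formula.IsValuation (· ∈ Γ)
  subset : L ⊆ Γ
  meet : ∀ t ∈ T, t.1 ⊆ Γ → t.2 ∈ Γ

/-- The Rasiowa–Sikorski lemma for predicate modal logics. -/
theorem exists_isWorld_notMem [Countable V] [∀ n, Countable (Pred n)]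
    (hL : IsPredicateModalLogic L) {T : Set (Set (Formula V Pred) × Formula V Pred)}
    (hT : T.Countable)
    (hmeet : ∀ t ∈ T, ∀ θ, (∀ χ ∈ t.1, imp θ χ ∈ L) → imp θ t.2 ∈ L)
    {φ : Formula V Pred} (hφ : φ ∉ L) : ∃ Γ, IsWorld L T Γ ∧ φ ∉ Γ := by
  have : Countable (Formula V Pred) := Formula.countable
  have : Countable T := hT.to_subtype
  obtain ⟨e, he⟩ := exists_surjective_nat (Formula V Pred ⊕ T)
  -- the conditions that the sequence of consistent formulas has to decide
  let dec : Formula V Pred ⊕ T → Formula V Pred → Prop := fun t θ => match t with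
    | .inl χ => imp θ χ ∈ L ∨ imp θ (.not χ) ∈ L
    | .inr t => imp θ t.1.2 ∈ L ∨ ∃ χ ∈ t.1.1, imp θ (.not χ) ∈ L
  have hsplit : ∀ θ χ : Formula V Pred, imp θ χ ∉ L →
      ∃ θ', Formula.not θ' ∉ L ∧ imp θ' θ ∈ L ∧ imp θ' (.not χ) ∈ L := by
    intro θ χ h
    -- `imp θ χ` unfolds to `not (and θ (not χ))`, so `h` itself is the consistency of `θ ∧ ¬χ`.
    refine ⟨.and θ (.not χ), h, ?_, ?_⟩ <;>
    · refine hL.mem_of_forall_valuation fun v hv => ?_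
      simp only [hv.imp, hv.and]
      tauto
  have hself : ∀ θ : Formula V Pred, imp θ θ ∈ L := fun θ =>
    hL.mem_of_forall_valuation fun v hv => (hv.imp _ _).2 id
  have hstep : ∀ (t : Formula V Pred ⊕ T) (θ : {θ : Formula V Pred // Formula.not θ ∉ L}),
      ∃ θ' : {θ : Formula V Pred // Formula.not θ ∉ L}, imp θ'.1 θ.1 ∈ L ∧ dec t θ'.1 := by
    rintro t ⟨θ, hθ⟩
    rcases t with χ | ⟨t, ht⟩
    · by_cases h : imp θ χ ∈ L
      · exact ⟨⟨θ, hθ⟩, hself θ, Or.inl h⟩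
      · obtain ⟨θ', h₁, h₂, h₃⟩ := hsplit θ χ h
        exact ⟨⟨θ', h₁⟩, h₂, Or.inr h₃⟩
    · by_cases h : imp θ t.2 ∈ L
      · exact ⟨⟨θ, hθ⟩, hself θ, Or.inl h⟩
      · obtain ⟨χ, hχ, h'⟩ : ∃ χ ∈ t.1, imp θ χ ∉ L := by
          by_contra! hcon
          exact h (hmeet t ht θ hcon)
        obtain ⟨θ', h₁, h₂, h₃⟩ := hsplit θ χ h'
        exact ⟨⟨θ', h₁⟩, h₂, Or.inr ⟨χ, hχ, h₃⟩⟩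
  choose next hnext hdec using hstep
  have hstart : Formula.not (.not φ) ∉ L := fun h => hφ (hL.mem_of_entails h fun v hv h => by
    simpa only [hv.not, not_not] using h)
  -- A descending sequence of consistent formulas that starts at `¬φ`; `θ (n + 1)` settles the
  -- condition `e n`. The filter generated by the sequence is the required world.
  let θ : ℕ → {θ : Formula V Pred // Formula.not θ ∉ L} :=
    fun n => Nat.rec ⟨.not φ, hstart⟩ (fun n θ => next (e n) θ) n
  have hmono : ∀ m n, m ≤ n → imp (θ n).1 (θ m).1 ∈ L := by
    intro m n hmn
    induction n, hmn using Nat.le_induction with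
    | base => exact hself _
    | succ n _ ih => exact hL.imp_trans (hnext (e n) (θ n)) ih
  let Γ : Set (Formula V Pred) := {χ | ∃ n, imp (θ n).1 χ ∈ L}
  have hcons : ∀ {χ}, χ ∈ Γ → Formula.not χ ∈ Γ → False := by
    rintro χ ⟨m, hm⟩ ⟨n, hn⟩
    have hm' := hL.imp_trans (hmono m (max m n) (le_max_left _ _)) hm
    have hn' := hL.imp_trans (hmono n (max m n) (le_max_right _ _)) hn
    refine (θ (max m n)).2 (hL.mem_of_entails₂ hm' hn' fun v hv h₁ h₂ => ?_)
    simp only [hv.imp, hv.not] at *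
    tauto
  have hcompl : ∀ χ, χ ∈ Γ ∨ Formula.not χ ∈ Γ := by
    intro χ
    obtain ⟨n, hn⟩ := he (.inl χ)
    have : dec (.inl χ) (θ (n + 1)).1 := hn ▸ hdec (e n) (θ n)
    exact Or.imp (fun h => ⟨n + 1, h⟩) (fun h => ⟨n + 1, h⟩) this
  have hsub : L ⊆ Γ := fun χ hχ => ⟨0, hL.mem_of_entails hχ fun v hv h => (hv.imp _ _).2 fun _ => h⟩
  have hmp : ∀ {χ ψ}, χ ∈ Γ → imp χ ψ ∈ L → ψ ∈ Γ := by
    rintro χ ψ ⟨n, hn⟩ h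
    exact ⟨n, hL.imp_trans hn h⟩
  have hnot : ∀ χ, Formula.not χ ∈ Γ ↔ χ ∉ Γ := fun χ =>
    ⟨fun h h' => hcons h' h, (hcompl χ).resolve_left⟩
  refine ⟨Γ, ⟨⟨?_, ?_, ?_, hnot⟩, hsub, ?_⟩, ?_⟩
  · exact hsub (hL.mem_of_forall_valuation fun v hv => hv.top)
  · rw [← hnot]
    exact hsub (hL.mem_of_forall_valuation fun v hv => (hv.not _).2 hv.bot)
  · intro χ ψ
    constructor
    · intro h
      constructor <;>
      · refine hmp h (hL.mem_of_forall_valuation fun v hv => ?_)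
        simp only [hv.imp, hv.and]
        tauto
    · rintro ⟨⟨m, hm⟩, ⟨n, hn⟩⟩
      have hm' := hL.imp_trans (hmono m (max m n) (le_max_left _ _)) hm
      have hn' := hL.imp_trans (hmono n (max m n) (le_max_right _ _)) hn
      refine ⟨max m n, hL.mem_of_entails₂ hm' hn' fun v hv h₁ h₂ => ?_⟩
      simp only [hv.imp, hv.and] at *
      tauto
  · intro t ht hsubt
    obtain ⟨n, hn⟩ := he (.inr ⟨t, ht⟩)
    have : dec (.inr ⟨t, ht⟩) (θ (n + 1)).1 := hn ▸ hdec (e n) (θ n)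
    rcases this with h | ⟨χ, hχ, h⟩
    · exact ⟨n + 1, h⟩
    · exact (hcons (hsubt hχ) ⟨n + 1, h⟩).elim
  · rw [← hnot]
    exact ⟨0, hself _⟩

end Derivations

/-! ### The canonical model and its truth lemma -/

section Canonical

variable {V : Type u} {Pred : ℕ → Type u}
  {L : Set (Formula V Pred)} {T : Set (Set (Formula V Pred) × Formula V Pred)}

theorem IsWorld.mp {Γ : Set (Formula V Pred)} (hΓ : IsWorld L T Γ) {φ ψ : Formula V Pred}
    (h : imp φ ψ ∈ L) (hφ : φ ∈ Γ) : ψ ∈ Γ :=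
  (hΓ.valuation.imp φ ψ).1 (hΓ.subset h) hφ

variable [Infinite V]

/-- The set of all worlds that contain `φ`. -/
def truthSet (L : Set (Formula V Pred)) (T : Set (Set (Formula V Pred) × Formula V Pred))
    (φ : Formula V Pred) : Set {Γ // IsWorld L T Γ} :=
  {Γ | φ ∈ Γ.1}

/-- The canonical model of `L` with respect to the infinitary meets in `T`. Its domain is the set of
variables, and its neighborhoods are the truth sets of necessary formulas, together with their
supersets if `L` is monotonic. -/
def canonicalModel (L : Set (Formula V Pred)) (T : Set (Set (Formula V Pred) × Formula V Pred))
    (h : ∃ Γ, IsWorld L T Γ) : NeighborhoodModel.{u, u} Pred where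
  C := {Γ // IsWorld L T Γ}
  nonempty_C := ⟨⟨h.choose, h.choose_spec⟩⟩
  N := fun Γ => {X | ∃ φ : Formula V Pred, .box φ ∈ Γ.1 ∧
    (truthSet L T φ = X ∨ LogicMT L ∧ truthSet L T φ ⊆ X)}
  D := V
  nonempty_D := inferInstance
  I := fun Γ _ P => {xs | .atom P xs ∈ Γ.1}

/-- The infimum `∀ x φ` of its instances. -/
def allMeet (t : V × Formula V Pred) : Set (Formula V Pred) × Formula V Pred :=
  (Set.range fun y => rename (Function.update id t.1 y) t.2, .all t.1 t.2)

variable [Countable V] [∀ n, Countable (Pred n)]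

/-- Completeness: an unprovable implication is refuted in some world, which separates the two truth
sets. -/
theorem truthSet_subset_iff (hL : IsPredicateModalLogic L) (hT : T.Countable)
    (hmeet : ∀ t ∈ T, ∀ θ, (∀ χ ∈ t.1, imp θ χ ∈ L) → imp θ t.2 ∈ L) {φ ψ : Formula V Pred} :
    truthSet L T φ ⊆ truthSet L T ψ ↔ imp φ ψ ∈ L := by
  refine ⟨fun h => ?_, fun h Γ hΓ => Γ.2.mp h hΓ⟩
  by_contra hn
  obtain ⟨Γ, hΓ, hmem⟩ := exists_isWorld_notMem hL hT hmeet hn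
  exact hmem ((hΓ.valuation.imp φ ψ).2 fun hφ => h (a := ⟨Γ, hΓ⟩) hφ)

/-- Membership does not depend on the formula that represents a truth set: equal truth sets come
from provably equivalent formulas, and supersets, present only under monotonicity, are handled by
`box_mono`. -/
theorem mem_canonicalModel_N_iff (hL : IsPredicateModalLogic L) (hT : T.Countable)
    (hmeet : ∀ t ∈ T, ∀ θ, (∀ χ ∈ t.1, imp θ χ ∈ L) → imp θ t.2 ∈ L)
    (h : ∃ Γ, IsWorld L T Γ) (Γ : {Γ // IsWorld L T Γ}) (φ : Formula V Pred) :
    truthSet L T φ ∈ (canonicalModel L T h).N Γ ↔ .box φ ∈ Γ.1 := by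
  refine ⟨?_, fun hφ => ⟨φ, hφ, Or.inl rfl⟩⟩
  rintro ⟨ψ, hψ, heq | ⟨hMT, hsub⟩⟩
  · have h₁ := (truthSet_subset_iff hL hT hmeet).1 heq.subset
    have h₂ := (truthSet_subset_iff hL hT hmeet).1 heq.superset
    exact Γ.2.mp (hL.iff_left (hL.congruence _ _ (hL.iff_intro h₁ h₂))) hψ
  · exact Γ.2.mp (hL.box_mono hMT ((truthSet_subset_iff hL hT hmeet).1 hsub)) hψ

/-- The truth lemma for the canonical model. -/
theorem val_canonicalModel (hL : IsPredicateModalLogic L) (hT : T.Countable)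
    (hmeet : ∀ t ∈ T, ∀ θ, (∀ χ ∈ t.1, imp θ χ ∈ L) → imp θ t.2 ∈ L)
    (hall : ∀ t : V × Formula V Pred, allMeet t ∈ T)
    (h : ∃ Γ, IsWorld L T Γ) (φ : Formula V Pred) :
    ∀ A : V → V, (canonicalModel L T h).val A φ = truthSet L T (rename A φ) := by
  induction φ with
  | top => intro A; ext Γ; exact ⟨fun _ => Γ.2.valuation.top, fun _ => trivial⟩
  | bot => intro A; ext Γ; exact ⟨False.elim, Γ.2.valuation.bot⟩
  | atom P xs => intro A; rfl
  | and φ ψ ih₁ ih₂ =>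
    intro A
    simp only [NeighborhoodModel.val, ih₁, ih₂]
    ext Γ
    exact (Γ.2.valuation.and _ _).symm
  | not φ ih =>
    intro A
    simp only [NeighborhoodModel.val, ih]
    ext Γ
    exact (Γ.2.valuation.not _).symm
  | box φ ih =>
    intro A
    simp only [NeighborhoodModel.val, ih]
    ext Γ
    exact mem_canonicalModel_N_iff hL hT hmeet h Γ _
  | all x φ ih =>
    intro A
    simp only [NeighborhoodModel.val, rename]
    have hz := Formula.pick_notMem (((freeVars φ).erase x).image A) x
    set z := pick (((freeVars φ).erase x).image A) x
    have hinst : ∀ y, iff (rename (Function.update id z y) (rename (Function.update A x z) φ))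
        (rename (Function.update A x y) φ) ∈ L := by
      intro y
      have := hL.rename_rename φ (Function.update id z y) (Function.update A x z)
      rwa [Formula.rename_update_comp_update hz, Function.id_comp] at this
    ext Γ
    simp only [Set.mem_iInter]
    constructor
    · intro hΓ
      -- The domain is the set of variables, so the semantic intersection runs over exactly the
      -- instances in `allMeet`, up to provable equivalence.
      refine Γ.2.meet _ (hall (z, rename (Function.update A x z) φ)) ?_
      rintro _ ⟨y, rfl⟩
      exact Γ.2.mp (hL.iff_right (hinst y)) ((ih (Function.update A x y)).subset (hΓ y))
    · intro hΓ y
      exact (ih (Function.update A x y)).superset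
        (Γ.2.mp (hL.iff_left (hinst y)) (Γ.2.mp (hL.instantiation z y _) hΓ))

end Canonical

end PML

/-! ### The model existence theorem -/

theorem theorem5p2 {V : Type u} [Countable V] [Infinite V]
    {Pred : ℕ → Type u} [∀ n, Countable (Pred n)]
    (L : Set (PML.Formula V Pred)) (hL : PML.IsPredicateModalLogic L) (hcons : PML.Consistent L)
    {K : Type w} [Countable K]
    (α : K → PML.Formula V Pred) (β : K → ℕ → PML.Formula V Pred)
    (hα : ∀ k, (α k).Closed) (hβ : ∀ k i, (β k i).Closed)
    (hadm : ∀ k, PML.Admits L (α k) (β k))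
    (hcount : ∀ k, PML.CountableInstances (β k)) :
    ∃ (M : PML.NeighborhoodModel.{u, u} Pred) (A : V → M.D),
      (∀ (k : K) (s : PML.Substitution V Pred Pred),
        M.val A (s.apply (α k)) = ⋂ i : ℕ, M.val A (s.apply (β k i))) ∧
      (∀ φ : PML.Formula V Pred, φ.Closed → (φ ∈ L ↔ M.Models φ)) ∧
      (PML.LogicMT L → M.MT) ∧
      (PML.LogicTP L → M.TP) ∧
      (PML.LogicCF L → M.CF) := by
  classical
  let T : Set (Set (PML.Formula V Pred) × PML.Formula V Pred) :=
    Set.range PML.allMeet ∪ ⋃ k, {t | ∃ s : PML.Substitution V Pred Pred,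
      t = ({φ | ∃ i : ℕ, φ = s.apply (β k i)}, s.apply (α k))}
  have : Countable (PML.Formula V Pred) := PML.Formula.countable
  have hT : T.Countable := by
    refine (Set.countable_range _).union (Set.countable_iUnion fun k => ?_)
    -- The countability condition bounds the sets of premises; the conclusions are formulas, of
    -- which there are only countably many.
    refine ((hcount k).prod Set.countable_univ).mono ?_
    rintro _ ⟨s, rfl⟩
    exact ⟨⟨s, rfl⟩, trivial⟩
  have hmeet : ∀ t ∈ T, ∀ θ, (∀ χ ∈ t.1, PML.Formula.imp θ χ ∈ L) →
      PML.Formula.imp θ t.2 ∈ L := by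
    rintro t (⟨⟨x, φ⟩, rfl⟩ | ht) θ h
    · exact hL.imp_all_of_forall_instances fun y => h _ ⟨y, rfl⟩
    · obtain ⟨k, s, rfl⟩ := Set.mem_iUnion.1 ht
      exact (hadm k).2 s θ fun i => h _ ⟨i, rfl⟩
  have hall : ∀ t, PML.allMeet t ∈ T := fun t => Or.inl ⟨t, rfl⟩
  have hne : ∃ Γ, PML.IsWorld L T Γ :=
    (PML.exists_isWorld_notMem hL hT hmeet hcons).imp fun _ h => h.1
  have hval := PML.val_canonicalModel hL hT hmeet hall hne
  -- Under the identity assignment, truth at a world is membership in it, so the required equation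
  -- for `s(α)` says that worlds respect the chosen infima.
  have hval_id : ∀ (φ : PML.Formula V Pred) (Γ : {Γ // PML.IsWorld L T Γ}),
      Γ ∈ (PML.canonicalModel L T hne).val (id : V → V) φ ↔ φ ∈ Γ.1 := fun φ Γ =>
    (Set.ext_iff.1 (hval φ id) Γ).trans (iff_of_eq (congrArg (· ∈ Γ.1) φ.rename_id))
  refine ⟨PML.canonicalModel L T hne, id, ?_, ?_, ?_, ?_, ?_⟩
  · intro k s
    ext Γ
    rw [Set.mem_iInter]
    constructor
    · intro h i
      exact (hval_id _ Γ).2 (Γ.2.mp ((hadm k).1 s i) ((hval_id _ Γ).1 h))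
    · intro h
      refine (hval_id _ Γ).2 (Γ.2.meet ({φ | ∃ i : ℕ, φ = s.apply (β k i)}, s.apply (α k))
        (Or.inr (Set.mem_iUnion.2 ⟨k, s, rfl⟩)) ?_)
      rintro _ ⟨i, rfl⟩
      exact (hval_id _ Γ).1 (h i)
  · intro φ hφ
    constructor
    · intro h Γ A
      refine (hval φ A).superset ?_
      exact (PML.Formula.rename_of_closed hφ A).symm ▸ Γ.2.subset h
    · intro h
      by_contra hn
      obtain ⟨Γ, hΓ, hmem⟩ := PML.exists_isWorld_notMem hL hT hmeet hn
      exact hmem ((hval_id φ ⟨Γ, hΓ⟩).1 (h ⟨Γ, hΓ⟩ id))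
  · rintro hMT Γ X Y ⟨φ, hφ, hX⟩ hXY
    exact ⟨φ, hφ, Or.inr ⟨hMT, (hX.elim Eq.subset And.right).trans hXY⟩⟩
  · intro hTP Γ
    refine ⟨.top, Γ.2.subset hTP, Or.inl ?_⟩
    ext Δ
    exact ⟨fun _ => trivial, fun _ => Δ.2.valuation.top⟩
  · rintro hCF Γ X Y ⟨φ, hφ, hX⟩ ⟨ψ, hψ, hY⟩
    refine ⟨.and φ ψ, Γ.2.mp (hL.and_box_imp hCF φ ψ) ((Γ.2.valuation.and _ _).2 ⟨hφ, hψ⟩), ?_⟩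
    have hand : PML.truthSet L T (.and φ ψ) = PML.truthSet L T φ ∩ PML.truthSet L T ψ := by
      ext Δ
      exact Δ.2.valuation.and φ ψ
    rw [hand]
    -- If `X` or `Y` is given only as a superset of a truth set, then `L` is monotonic and `X ∩ Y`
    -- may be given as a superset as well.
    rcases hX with rfl | ⟨hMT, hX⟩
    · rcases hY with rfl | ⟨hMT, hY⟩
      · exact Or.inl rfl
      · exact Or.inr ⟨hMT, Set.inter_subset_inter_right _ hY⟩
    · exact Or.inr ⟨hMT, Set.inter_subset_inter hX (hY.elim Eq.subset And.right)⟩
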